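/- Let $\mathcal D$ be a triangulated category (for instance the homotopy category of a stable $\infty$-category). A $\mathbb Z$-poset is a poset with an action of $\mathbb Z$ by monotone maps such that $x\le x+1$; morphisms are monotone $\mathbb Z$-equivariant maps. The t-structures $(\mathcal D_{<0},\mathcal D_{\ge 0})$ on $\mathcal D$ form a $\mathbb Z$-poset $\mathrm{ts}(\mathcal D)$: $\mathfrak t_1\le\mathfrak t_2$ iff $\mathcal D_{\mathfrak t_2;\ge 0}\subseteq \mathcal D_{\mathfrak t_1;\ge 0}$, and $\mathfrak t+1=\mathfrak t[1]$ has $\mathcal D_{\mathfrak t+1;\ge0}=\mathcal D_{\mathfrak t;\ge 0}[1]$. For a $\mathbb Z$-poset $J$, let $\mathcal O(J)$ be the $\mathbb Z$-poset of upper sets of $J$, ordered by reverse inclusion, with the translation action. For a totally ordered $\mathbb Z$-poset $J$, a Bridgeland $J$-slicing of $\mathcal D$ is a morphism of $\mathbb Z$-posets $\mathcal O(J)\to \mathrm{ts}(\mathcal D)$ such that, with $\mathcal H^j(X)$ the truncation of $X$ to $\mathcal D_{\ge j}$ and then to $\mathcal D_{\le j}$ (with respect to the t-structures at $[j,+\infty)$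 and at $(j,+\infty)$), every object $X$ has only finitely many nonzero $\mathcal H^j(X)$, and $X=0$ if all of them vanish; its slices are $\mathcal D_j=\mathcal D_{\ge j}\cap\mathcal D_{\le j}$. A t-structure $\mathfrak t$ is bounded if every object lies in $\mathcal D_{\mathfrak t;\ge a}\cap \mathcal D_{\mathfrak t;\le b}$ for some $a,b\in\mathbb Z$. Let $\hat{\mathbb Z}$ be $\mathbb Z$ with the trivial action. An abelian $\mathbb Z$-slicing on the heart $\heartsuit_{\mathfrak t}$ of a bounded t-structure $\mathfrak t$ is a Bridgeland $\mathbb Z\times_{\mathrm{lex}}\hat{\mathbb Z}$-slicing $\tilde{\mathfrak t}$ of $\mathcal D$ that extends $\mathfrak t$: for each $n$, the upper set $\{(a,\phi): a\ge n\}$ is sent to $\mathfrak t+n$. Put $\heartsuit_{\mathfrak t;\phi}=\mathcal D_{\tilde{\mathfrak t};(0,\phi)}$. It is gluable if $\mathrm{Hom}(X,Y[n])=0$ for all $X\in\heartsuit_{\mathfrak t;\phi}$ and $Y\in\heartsuit_{\mathfrak t;\psi}$ whenever $\phi>\psi$ and $n>0$. A perversity function is a map $p:\mathbb Z\to\mathbb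 Z$ with $p(n)\le p(n+1)\le p(n)+1$ for all $n$. Let $U_p\subseteq\mathbb Z\times\mathbb Z$ be the complement of the image of $\{(n,n'): n'\ge p(n)-n\}$ under $(n,n')\mapsto(-n-n',-n')$; it is an upper set for the product order. Give $\mathbb Z\times\mathbb Z$ the product order and the action $(a,b)+1=(a+1,b+1)$. Theorem. Let $\mathfrak t$ be a bounded t-structure on $\mathcal D$ and $\tilde{\mathfrak t}$ a gluable abelian $\mathbb Z$-slicing on $\heartsuit_{\mathfrak t}$. Then there is a morphism of $\mathbb Z$-posets $$\Psi:\mathcal O(\mathbb Z\times\mathbb Z)\to\mathrm{ts}(\mathcal D)$$ such that: (1) for every perversity function $p$, $\Psi(U_p)=(\gamma_p)_!\tilde{\mathfrak t}$, where $\gamma_p(n,\phi)=n+p(\phi)$; that is, for all $m\in\mathbb Z$, the upper and lower subcategories of $\Psi(U_p)+m$ are the extension-closed subcategories generated by the slices $\mathcal D_{\tilde{\mathfrak t};(n,\phi)}$ with $n+p(\phi)\ge m$ and with $n+p(\phi)<m$, respectively; (2) $\Psi$ preserves maximum and minimum: $\Psi(\emptyset)$ is the largest and $\Psi(\mathbb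 Z\times\mathbb Z)$ the smallest t-structure on $\mathcal D$. The map $\Psi$ is uniquely determined by (1) and (2), and for every upper set $U\ne\emptyset,\ \mathbb Z\times\mathbb Z$ the t-structure $\Psi(U)$ is bounded. -/

import Mathlib

open CategoryTheory CategoryTheory.Limits CategoryTheory.Pretriangulated
open CategoryTheory.Triangulated
open scoped Pointwise

universe v u

namespace Gluing

/-! ### Posets with a monotone action of the integers -/

/-- A `ℤ`-poset: a poset with an action of `ℤ` by monotone maps such that `x ≤ x + 1`. -/
class IsZPoset (P : Type*) [PartialOrder P] [AddAction ℤ P] : Prop where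
  vadd_mono (n : ℤ) {x y : P} (h : x ≤ y) : n +ᵥ x ≤ n +ᵥ y
  le_one_vadd (x : P) : x ≤ (1 : ℤ) +ᵥ x

/-- Morphisms of `ℤ`-posets: monotone `ℤ`-equivariant maps. -/
structure ZPosetHom (P Q : Type*) [PartialOrder P] [AddAction ℤ P]
    [PartialOrder Q] [AddAction ℤ Q] extends P →o Q where
  map_vadd' (n : ℤ) (x : P) : toFun (n +ᵥ x) = n +ᵥ toFun x

instance (P Q : Type*) [PartialOrder P] [AddAction ℤ P] [PartialOrder Q] [AddAction ℤ Q] :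
    CoeFun (ZPosetHom P Q) (fun _ => P → Q) where
  coe f := f.toFun

/-- `ℤ` with translation action. -/
instance : IsZPoset ℤ where
  vadd_mono n _ _ h := by simpa using h
  le_one_vadd x := by simp

/-- `ℤ × ℤ` with the product order and the diagonal action `(a, b) + 1 = (a + 1, b + 1)`. -/
instance : IsZPoset (ℤ × ℤ) where
  vadd_mono n x y h := ⟨by simpa using h.1, by simpa using h.2⟩
  le_one_vadd x := ⟨by simp, by simp⟩

/-- The totally ordered set of integers, to be endowed with the trivial action of `ℤ`. -/
def ZHat : Type := ℤ

/-- The underlying integer. -/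
def ZHat.val (φ : ZHat) : ℤ := φ

instance : LinearOrder ZHat := inferInstanceAs (LinearOrder ℤ)

instance : AddAction ℤ ZHat where
  vadd _ φ := φ
  zero_vadd _ := rfl
  add_vadd _ _ _ := rfl

instance : IsZPoset ZHat where
  vadd_mono _ _ _ h := h
  le_one_vadd x := le_refl x

/-- The lexicographic product of `ℤ` and `ZHat`. -/
abbrev LexIndex : Type := ℤ ×ₗ ZHat

/-- The diagonal action of `ℤ` on the lexicographic product; since `ℤ` acts trivially on
`ZHat`, this is `(a, φ) + n = (a + n, φ)`. -/
instance : AddAction ℤ LexIndex where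
  vadd n x := toLex (n +ᵥ (ofLex x).1, n +ᵥ (ofLex x).2)
  zero_vadd _ := Prod.ext (zero_add _) rfl
  add_vadd _ _ _ := Prod.ext (add_assoc _ _ _) rfl

instance : IsZPoset LexIndex where
  vadd_mono n x y h := by
    rw [Prod.Lex.le_iff] at h ⊢
    rcases h with h | ⟨h1, h2⟩
    · exact Or.inl (add_lt_add_right h n)
    · exact Or.inr ⟨congrArg (n + ·) h1, h2⟩
  le_one_vadd x := by
    rw [Prod.Lex.le_iff]
    exact Or.inl (lt_one_add (ofLex x).1)

/-! ### The `ℤ`-poset of upper sets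

A decomposition of `J` into a lower set `L` and an upper set `U` is given by `U`. The order on
`UpperSet J` is reverse inclusion, so that `j ↦ [j, +∞)` is monotone; its maximum `⊤` is the empty
set and its minimum `⊥` is all of `J`. -/

section UpperSets

variable {J : Type*} [PartialOrder J] [AddAction ℤ J] [IsZPoset J]

/-- `U + n` is the translate of `U` by `n`. -/
instance : VAdd ℤ (UpperSet J) where
  vadd n U :=
    { carrier := n +ᵥ (U : Set J)
      upper' := by
        intro x y hxy hx
        rw [Set.mem_vadd_set_iff_neg_vadd_mem] at hx ⊢
        exact U.upper (IsZPoset.vadd_mono _ hxy) hx }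

lemma coe_vadd_upperSet (n : ℤ) (U : UpperSet J) :
    ((n +ᵥ U : UpperSet J) : Set J) = n +ᵥ (U : Set J) := rfl

instance : AddAction ℤ (UpperSet J) where
  zero_vadd U := SetLike.coe_injective (by rw [coe_vadd_upperSet, zero_vadd])
  add_vadd m n U := SetLike.coe_injective (by simp only [coe_vadd_upperSet, add_vadd])

instance : IsZPoset (UpperSet J) where
  vadd_mono n U V h := Set.vadd_set_mono (a := n) (show (V : Set J) ⊆ (U : Set J) from h)
  le_one_vadd U := by
    rintro _ ⟨x, hx, rfl⟩
    exact U.upper (IsZPoset.le_one_vadd x) hx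

end UpperSets

/-- The inverse image of an upper set along a monotone map. -/
def upperPreimage {J J' : Type*} [PartialOrder J] [PartialOrder J'] (f : J → J')
    (hf : Monotone f) (U : UpperSet J') : UpperSet J where
  carrier := f ⁻¹' (U : Set J')
  upper' := U.upper.preimage hf

/-- The projection on the first factor. -/
def projFst (x : LexIndex) : ℤ := (ofLex x).1

lemma monotone_projFst : Monotone projFst := by
  intro x y h
  rw [Prod.Lex.le_iff] at h
  rcases h with h | h
  · exact le_of_lt h
  · exact le_of_eq h.1

/-! ### The `ℤ`-poset of t-structures -/

section Triangulated

variable {C : Type u} [Category.{v} C] [Preadditive C] [HasZeroObject C] [HasShift C ℤ]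
  [∀ n : ℤ, (shiftFunctor C n).Additive] [Pretriangulated C]

/-- In the cohomological indexing of `TStructure`, the upper subcategory of `t` (the connective
part `D_{≥ 0}` in homological indexing) is `t.le 0`. -/
def upperPart (t : TStructure C) : ObjectProperty C := t.le 0

/-- The lower subcategory of `t` (`D_{< 0}` in homological indexing). -/
def lowerPart (t : TStructure C) : ObjectProperty C := t.ge 1

lemma tStructure_ext {t₁ t₂ : TStructure C} (h : upperPart t₁ = upperPart t₂) : t₁ = t₂ := by
  have h0 : t₁.le 0 = t₂.le 0 := h
  have hle : t₁.le = t₂.le := by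
    funext n
    rw [← t₁.shift_le n 0 n (by lia), ← t₂.shift_le n 0 n (by lia), h0]
  have hge : t₁.ge = t₂.ge := by
    funext n
    ext X
    simp only [TStructure.ge_iff_isGE]
    rw [t₁.isGE_iff_orthogonal (n - 1) n (by lia), t₂.isGE_iff_orthogonal (n - 1) n (by lia)]
    simp only [← TStructure.le_iff_isLE, hle]
  cases t₁
  cases t₂
  simp only at hle hge
  subst hle hge
  rfl

/-- `t₁ ≤ t₂` if and only if the upper subcategory of `t₂` is contained in that of `t₁`. -/
instance : PartialOrder (TStructure C) where
  le t₁ t₂ := upperPart t₂ ≤ upperPart t₁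
  le_refl t := le_refl (upperPart t)
  le_trans _ _ _ h h' := le_trans h' h
  le_antisymm _ _ h h' := tStructure_ext (le_antisymm h' h)

/-- `t + n` is the shifted t-structure `t[n]`, whose upper subcategory is `D_{≥ 0}[n] = D_{≥ n}`
in homological indexing. -/
def shiftT (n : ℤ) (t : TStructure C) : TStructure C where
  le k := t.le (k - n)
  ge k := t.ge (k - n)
  le_shift k a k' h X hX := t.le_shift (k - n) a (k' - n) (by lia) X hX
  ge_shift k a k' h X hX := t.ge_shift (k - n) a (k' - n) (by lia) X hX
  zero' X Y f hX hY :=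
    t.zero_of_isLE_of_isGE f (0 - n) (1 - n) (by lia) ⟨hX⟩ ⟨hY⟩
  le_zero_le := t.le_monotone (by lia)
  ge_one_le := t.ge_antitone (by lia)
  exists_triangle_zero_one A := t.exists_triangle A (0 - n) (1 - n) (by lia)

instance : AddAction ℤ (TStructure C) where
  vadd := shiftT
  zero_vadd t := tStructure_ext (congrArg t.le (show (0 : ℤ) - 0 = 0 by lia))
  add_vadd m n t := tStructure_ext (congrArg t.le (show (0 : ℤ) - (m + n) = 0 - m - n by lia))

instance : IsZPoset (TStructure C) where
  vadd_mono n t₁ t₂ h := by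
    have h0 : t₂.le 0 ≤ t₁.le 0 := h
    intro X hX
    have hX' : t₂.le (0 - n) X := hX
    change t₁.le (0 - n) X
    rw [← TStructure.shift_le _ (0 - n) 0 (0 - n) (by lia)] at hX' ⊢
    exact h0 _ hX'
  le_one_vadd t := t.le_monotone (by lia : (0 : ℤ) - 1 ≤ 0)

/-- A t-structure is bounded if every object lies in `D_{≥ a} ∩ D_{≤ b}` for some `a`, `b`. -/
def IsBounded (t : TStructure C) : Prop := ∀ X : C, t.bounded X

/-! ### Slicings -/

section Slicings

variable {J : Type*} [LinearOrder J] [AddAction ℤ J] [IsZPoset J]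

/-- The `j`-th slice `D_j` of a `J`-slicing: the intersection of `D_{≥ j}`, the upper subcategory
at `[j, +∞)`, and `D_{≤ j}`, the lower subcategory at `((-∞, j], (j, +∞))`. -/
def sliceOf (s : UpperSet J → TStructure C) (j : J) : ObjectProperty C :=
  upperPart (s (UpperSet.Ici j)) ⊓ lowerPart (s (UpperSet.Ioi j))

/-- The `j`-th cohomology object `H^j(X)`: the truncation of `X` to `D_{≥ j}`, followed by the
truncation to `D_{≤ j}`. -/
noncomputable def cohomologyOf (s : UpperSet J → TStructure C) (j : J) (X : C) : C :=
  ((s (UpperSet.Ioi j)).truncGE 1).obj (((s (UpperSet.Ici j)).truncLE 0).obj X)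

variable (J C) in
/-- A Bridgeland `J`-slicing of `C`: a morphism of `ℤ`-posets from the upper sets of `J` to the
t-structures on `C` which is discrete and finite. -/
structure BridgelandSlicing extends ZPosetHom (UpperSet J) (TStructure C) where
  discrete (X : C) (h : ∀ j : J, IsZero (cohomologyOf toFun j X)) : IsZero X
  finite (X : C) : {j : J | ¬ IsZero (cohomologyOf toFun j X)}.Finite

/-- The slices `D_j` of a Bridgeland slicing. -/
def BridgelandSlicing.slice (s : BridgelandSlicing C J) (j : J) : ObjectProperty C :=
  sliceOf s.toFun j

/-- The extension-closed subcategory `⟨P⟩` generated by `P` (containing the zero objects and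
closed under isomorphisms). -/
inductive extensionClosure (P : ObjectProperty C) : ObjectProperty C
  | zero (X : C) (h : IsZero X) : extensionClosure P X
  | of (X : C) (h : P X) : extensionClosure P X
  | ext (T : Triangle C) (hT : T ∈ distTriang C) (h₁ : extensionClosure P T.obj₁)
      (h₃ : extensionClosure P T.obj₃) : extensionClosure P T.obj₂

/-- For a map `f : J → ℤ`, the bounded `ℤ`-slicing `f_! s`, which sends an upper set `U` of `ℤ` to
the pair `(⟨D_j : f j ∉ U⟩, ⟨D_j : f j ∈ U⟩)`, is the one given by the t-structure `t`; here `t` is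
identified with the map sending `[n, +∞)` to `t + n`. -/
def IsPushforward (f : J → ℤ) (s : BridgelandSlicing C J) (t : TStructure C) : Prop :=
  ∀ n : ℤ,
    upperPart (n +ᵥ t) =
      extensionClosure (fun X => ∃ j, f j ∈ UpperSet.Ici n ∧ s.slice j X) ∧
    lowerPart (n +ᵥ t) =
      extensionClosure (fun X => ∃ j, f j ∉ UpperSet.Ici n ∧ s.slice j X)

end Slicings

/-- An abelian `ℤ`-slicing on the heart of `t`: a Bridgeland slicing of `C` indexed by the
lexicographic product `ℤ × ZHat` that extends `t`, i.e. whose direct image along the first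
projection is the `ℤ`-slicing `[n, +∞) ↦ t + n`. -/
structure AbelianSlicing (t : TStructure C) extends BridgelandSlicing C LexIndex where
  extends_t (n : ℤ) :
    toFun (upperPreimage projFst monotone_projFst (UpperSet.Ici n)) = n +ᵥ t

/-- The `φ`-th slice `♥_φ = D_{(0, φ)}` of the heart. -/
def AbelianSlicing.heartSlice {t : TStructure C} (s : AbelianSlicing t) (φ : ZHat) :
    ObjectProperty C :=
  s.toBridgelandSlicing.slice (toLex (0, φ))

/-- Gluability: there are no nonzero morphisms from `♥_φ` to `♥_ψ[n]` when `φ > ψ` and `n > 0`. -/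
def AbelianSlicing.IsGluable {t : TStructure C} (s : AbelianSlicing t) : Prop :=
  ∀ (φ ψ : ZHat) (n : ℤ), ψ < φ → 0 < n → ∀ (X Y : C), s.heartSlice φ X → s.heartSlice ψ Y →
    ∀ f : X ⟶ Y⟦n⟧, f = 0

/-! ### Perversity functions -/

/-- Perversity functions on `ℤ`. -/
structure PerversityFunction where
  toFun : ℤ → ℤ
  le_succ (n : ℤ) : toFun n ≤ toFun (n + 1)
  succ_le (n : ℤ) : toFun (n + 1) ≤ toFun n + 1

/-- The upper set of `ℤ × ℤ` attached to a perversity function `p`: the complement of the image of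
`{(n, n') | n' ≥ p n - n}` under `(n, n') ↦ (-n - n', -n')`. -/
def PerversityFunction.upperSet (p : PerversityFunction) : UpperSet (ℤ × ℤ) where
  carrier := ((fun x : ℤ × ℤ => (-x.1 - x.2, -x.2)) '' {x | p.toFun x.1 - x.1 ≤ x.2})ᶜ
  upper' := by
    have hmono : Monotone p.toFun := monotone_int_of_le_succ p.le_succ
    have hanti : Antitone (fun n : ℤ => p.toFun n - n) :=
      antitone_int_of_succ_le (fun n => by have := p.succ_le n; lia)
    rintro ⟨a, b⟩ ⟨a', b'⟩ ⟨h1, h2⟩ hx ⟨⟨n, m⟩, hy, he⟩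
    simp only [Set.mem_ofPred_eq, Prod.mk.injEq] at h1 h2 hy he
    refine hx ⟨(b - a, -b), ?_, by simp⟩
    have e1 := hanti (show n - (b' - b) ≤ b - a by lia)
    have e2 := hmono (show n - (b' - b) ≤ n by lia)
    simp only [Set.mem_ofPred_eq] at e1 e2 ⊢
    lia

/-- The equivariant map `γ_p : (n, φ) ↦ n + p φ`. -/
def PerversityFunction.gamma (p : PerversityFunction) (x : LexIndex) : ℤ :=
  (ofLex x).1 + p.toFun (ofLex x).2.val

/-- `Ψ` is the map induced by the abelian slicing `s`: the upper set attached to a perversity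
function `p` is sent to `(γ_p)_! s`, and maximum and minimum are preserved. -/
def IsInduced {t : TStructure C} (s : AbelianSlicing t)
    (Ψ : UpperSet (ℤ × ℤ) → TStructure C) : Prop :=
  (∀ p : PerversityFunction, IsPushforward p.gamma s.toBridgelandSlicing (Ψ p.upperSet)) ∧
    IsTop (Ψ ⊤) ∧ IsBot (Ψ ⊥)

end Triangulated

end Gluing

/-! The upper part of `Ψ U` is generated by the slices of index `(n, φ)` with `(n + 1, n + 1 + φ) ∈
U`, and its lower part by the remaining slices (`glueIndex`, `glue`).

Both t-structure axioms that need work come from one comparison. Let `(n, φ)` be an index inside the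
set and `(m, ψ)` one outside. If `(m, ψ) < (n, φ)` lexicographically, the slicing itself kills
morphisms from inside to outside. Otherwise `n ≤ m`, and since `U` is an upper set, `m + ψ < n + φ`;
hence `ψ < φ`, and gluability kills the morphisms into strictly positive relative shifts. In degree
0 this gives orthogonality (`slicesClosure_hom_eq_zero`). In degree 1 it splits the extensions that
are in the wrong order, so the finite Harder–Narasimhan filtration can be rearranged with the inside
slices first (`BridgelandSlicing.exists_isExt_of_support`), which yields the truncation triangle.

Uniqueness holds because every nontrivial upper set is some `U_p` (`exists_perversityFunction`).
Boundedness holds because an object involves finitely many slices, each of which enters or leaves a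
nontrivial `U` after enough diagonal shifts. -/

namespace Gluing

/-! ### Extensions in a triangulated category -/

section Extensions

variable {C : Type u} [Category.{v} C] [Preadditive C] [HasZeroObject C] [HasShift C ℤ]
  [∀ n : ℤ, (shiftFunctor C n).Additive] [Pretriangulated C]

/-- `X` is an extension of `B` by `A`: there is a distinguished triangle `A ⟶ X ⟶ B ⟶ A⟦1⟧`. -/
def IsExt (A X B : C) : Prop :=
  ∃ (f : A ⟶ X) (g : X ⟶ B) (h : B ⟶ A⟦(1 : ℤ)⟧), Triangle.mk f g h ∈ distTriang C

namespace IsExt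

lemma of_triangle (T : Triangle C) (hT : T ∈ distTriang C) : IsExt T.obj₁ T.obj₂ T.obj₃ :=
  ⟨T.mor₁, T.mor₂, T.mor₃, hT⟩

lemma of_iso {A X B A' X' B' : C} (h : IsExt A X B) (a : A ≅ A') (x : X ≅ X') (b : B ≅ B') :
    IsExt A' X' B' := by
  obtain ⟨f, g, h, hT⟩ := h
  refine ⟨a.inv ≫ f ≫ x.hom, x.inv ≫ g ≫ b.hom, b.inv ≫ h ≫ a.hom⟦1⟧',
    isomorphic_distinguished _ hT _ (Triangle.isoMk _ _ a.symm x.symm b.symm ?_ ?_ ?_)⟩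
  · change (a.inv ≫ f ≫ x.hom) ≫ x.inv = a.inv ≫ f
    simp
  · change (x.inv ≫ g ≫ b.hom) ≫ b.inv = x.inv ≫ g
    simp
  · change (b.inv ≫ h ≫ a.hom⟦1⟧') ≫ a.inv⟦1⟧' = b.inv ≫ h
    simp

lemma of_isZero_left {Z : C} (hZ : IsZero Z) (X : C) : IsExt Z X X :=
  (of_triangle _ (contractible_distinguished₁ X)).of_iso ((isZero_zero C).iso hZ)
    (Iso.refl _) (Iso.refl _)

lemma of_isZero_right {Z : C} (hZ : IsZero Z) (X : C) : IsExt X X Z :=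
  (of_triangle _ (contractible_distinguished X)).of_iso (Iso.refl _)
    (Iso.refl _) ((isZero_zero C).iso hZ)

lemma rotate {A X B : C} (h : IsExt A X B) : IsExt X B (A⟦(1 : ℤ)⟧) := by
  obtain ⟨f, g, h, hT⟩ := h
  exact of_triangle _ (rot_of_distTriang _ hT)

lemma invRotate {A X B : C} (h : IsExt A X B) : IsExt (B⟦(-1 : ℤ)⟧) A X := by
  obtain ⟨f, g, h, hT⟩ := h
  exact of_triangle _ (inv_rot_of_distTriang _ hT)

lemma nonempty_iso_of_isZero {A X B : C} (h : IsExt A X B) (hA : IsZero A) :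
    Nonempty (X ≅ B) := by
  obtain ⟨f, g, h, hT⟩ := h
  have : IsIso g := (Triangle.isZero₁_iff_isIso₂ _ hT).1 hA
  exact ⟨asIso g⟩

/-- A vanishing connecting morphism splits the triangle, so `X` is a biproduct and its two pieces
may be read in either order. -/
lemma swap {A X B : C} (h : IsExt A X B) (h0 : ∀ f : B ⟶ A⟦(1 : ℤ)⟧, f = 0) : IsExt B X A := by
  obtain ⟨f, g, h, hT⟩ := h
  obtain ⟨e, -⟩ := exists_iso_binaryBiproduct_of_distTriang _ hT (h0 h)
  exact (of_triangle _ (binaryBiproductTriangle_distinguished B A)).of_iso (Iso.refl _)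
    (biprod.braiding B A ≪≫ e.symm) (Iso.refl _)

/-- Octahedral axiom: a filtration with successive pieces `A`, `B₁`, `B₂` is rebracketed.
`assoc_right` is the dual regrouping. -/
lemma assoc_left [IsTriangulated C] {A X B B₁ B₂ : C} (h : IsExt A X B) (h' : IsExt B₁ B B₂) :
    ∃ T, IsExt T X B₂ ∧ IsExt A T B₁ := by
  obtain ⟨f, g, h, hT⟩ := h
  obtain ⟨f', g', h', hT'⟩ := h'
  obtain ⟨T, v, w, hv⟩ := distinguished_cocone_triangle₁ (g ≫ g')
  exact ⟨T, ⟨_, _, _, hv⟩, of_triangle _ (someOctahedron' rfl hT hT' hv).mem⟩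

lemma assoc_right [IsTriangulated C] {A X B A₁ A₂ : C} (h : IsExt A X B) (h' : IsExt A₁ A A₂) :
    ∃ T, IsExt A₁ X T ∧ IsExt A₂ T B := by
  obtain ⟨f, g, h, hT⟩ := h
  obtain ⟨f', g', h', hT'⟩ := h'
  obtain ⟨T, v, w, hv⟩ := distinguished_cocone_triangle (f' ≫ f)
  exact ⟨T, ⟨_, _, _, hv⟩, of_triangle _ (someOctahedron rfl hT' hT hv).mem⟩

end IsExt

lemma exists_isExt_upperPart_lowerPart (t : TStructure C) (X : C) :
    ∃ A B, upperPart t A ∧ lowerPart t B ∧ IsExt A X B := by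
  obtain ⟨A, B, hA, hB, f, g, h, hT⟩ := t.exists_triangle_zero_one X
  exact ⟨A, B, hA, hB, f, g, h, hT⟩

lemma IsExt.upperPart {t : TStructure C} {A X B : C} (h : IsExt A X B)
    (hA : upperPart t A) (hB : upperPart t B) : upperPart t X := by
  obtain ⟨f, g, h, hT⟩ := h
  exact (t.isLE₂ _ hT 0 ⟨hA⟩ ⟨hB⟩).le

lemma IsExt.lowerPart {t : TStructure C} {A X B : C} (h : IsExt A X B)
    (hA : lowerPart t A) (hB : lowerPart t B) : lowerPart t X := by
  obtain ⟨f, g, h, hT⟩ := h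
  exact (t.isGE₂ _ hT 1 ⟨hA⟩ ⟨hB⟩).ge

lemma upperPart_shift {t : TStructure C} {X : C} (h : upperPart t X) :
    upperPart t (X⟦(1 : ℤ)⟧) :=
  t.le_monotone (by lia : (-1 : ℤ) ≤ 0) _ (t.le_shift 0 1 (-1) (by lia) X h)

lemma lowerPart_shift {t : TStructure C} {X : C} (h : lowerPart t X) :
    lowerPart t (X⟦(-1 : ℤ)⟧) :=
  t.ge_antitone (by lia : (1 : ℤ) ≤ 2) _ (t.ge_shift 1 (-1) 2 (by lia) X h)

lemma upperPart_of_isZero (t : TStructure C) {X : C} (h : IsZero X) : upperPart t X :=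
  (t.isLE_of_isZero h 0).le

lemma lowerPart_of_isZero (t : TStructure C) {X : C} (h : IsZero X) : lowerPart t X :=
  (t.isGE_of_isZero h 1).ge

/-- The lower part is the right orthogonal of the upper part. -/
lemma lowerPart_antitone {t₁ t₂ : TStructure C} (h : t₁ ≤ t₂) : lowerPart t₁ ≤ lowerPart t₂ := by
  intro X hX
  have h1 := (t₁.isGE_iff_orthogonal 0 1 (by lia) X).1 ⟨hX⟩
  exact ((t₂.isGE_iff_orthogonal 0 1 (by lia) X).2 fun Y f hY => h1 Y f ⟨h _ hY.le⟩).ge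

/-! ### Extension closures -/

namespace extensionClosure

variable {P Q : ObjectProperty C}

lemma of_isExt {A X B : C} (h : IsExt A X B) (hA : extensionClosure P A)
    (hB : extensionClosure P B) : extensionClosure P X := by
  obtain ⟨f, g, h, hT⟩ := h
  exact .ext _ hT hA hB

instance : (extensionClosure P).IsClosedUnderIsomorphisms where
  of_iso e h := of_isExt ((IsExt.of_isZero_right (isZero_zero C) _).of_iso (Iso.refl _) e
    (Iso.refl _)) h (.zero _ (isZero_zero C))

lemma shift (a : ℤ) (h : ∀ X, P X → Q (X⟦a⟧)) {X : C} (hX : extensionClosure P X) :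
    extensionClosure Q (X⟦a⟧) := by
  induction hX with
  | zero X hX => exact .zero _ (Functor.map_isZero _ hX)
  | of X hX => exact .of _ (h X hX)
  | ext T hT _ _ h₁ h₃ =>
    exact .ext ((Triangle.shiftFunctor C a).obj T) (Triangle.shift_distinguished T hT a) h₁ h₃

lemma mono (h : P ≤ Q) : extensionClosure P ≤ extensionClosure Q := by
  intro X hX
  induction hX with
  | zero X hX => exact .zero _ hX
  | of X hX => exact .of _ (h X hX)
  | ext T hT _ _ h₁ h₃ => exact .ext T hT h₁ h₃

lemma hom_eq_zero_left {Y : C} (h : ∀ X, P X → ∀ f : X ⟶ Y, f = 0) {X : C}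
    (hX : extensionClosure P X) (f : X ⟶ Y) : f = 0 := by
  induction hX with
  | zero X hX => exact hX.eq_of_src _ _
  | of X hX => exact h X hX f
  | ext T hT _ _ h₁ h₃ =>
    obtain ⟨g, rfl⟩ := Triangle.yoneda_exact₂ T hT f (h₁ _)
    rw [h₃ g, comp_zero]

lemma hom_eq_zero_right {X : C} (h : ∀ Y, Q Y → ∀ f : X ⟶ Y, f = 0) {Y : C}
    (hY : extensionClosure Q Y) (f : X ⟶ Y) : f = 0 := by
  induction hY with
  | zero X hX => exact hX.eq_of_tgt _ _
  | of X hX => exact h X hX f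
  | ext T hT _ _ h₁ h₃ =>
    obtain ⟨g, rfl⟩ := Triangle.coyoneda_exact₂ T hT f (h₃ _)
    rw [h₁ g, zero_comp]

lemma hom_eq_zero (h : ∀ X Y, P X → Q Y → ∀ f : X ⟶ Y, f = 0) {X Y : C}
    (hX : extensionClosure P X) (hY : extensionClosure Q Y) (f : X ⟶ Y) : f = 0 :=
  hom_eq_zero_left (fun X hX => hom_eq_zero_right (fun Y hY => h X Y hX hY) hY) hX f

end extensionClosure

/-- Truncation triangles are unique up to isomorphism, so any decomposition at `[j, +∞)` computes
`H^j`. This frees later arguments from the truncation functors. -/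
lemma isZero_cohomologyOf_iff {J : Type*} [LinearOrder J] (s : UpperSet J → TStructure C) (j : J) {A X B : C}
    (h : IsExt A X B) (hA : upperPart (s (.Ici j)) A) (hB : lowerPart (s (.Ici j)) B) :
    IsZero (cohomologyOf s j X) ↔ upperPart (s (.Ioi j)) A := by
  obtain ⟨f, g, h, hT⟩ := h
  obtain ⟨e, -⟩ := (s (.Ici j)).triangle_iso_exists hT
    ((s (.Ici j)).triangleLEGE_distinguished 0 1 (by lia) X) (Iso.refl X) 0 1 ⟨hA⟩ ⟨hB⟩
    (inferInstance : (s (.Ici j)).IsLE (((s (.Ici j)).truncLE 0).obj X) 0)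
    (inferInstance : (s (.Ici j)).IsGE (((s (.Ici j)).truncGE 1).obj X) 1)
  have e' : A ≅ ((s (.Ici j)).truncLE 0).obj X := Triangle.π₁.mapIso e
  rw [cohomologyOf, ← (s (.Ioi j)).isLE_iff_isZero_truncGE_obj 0 1 (by lia),
    ← TStructure.le_iff_isLE]
  exact ((s (.Ioi j)).le 0).prop_iff_of_iso e'.symm

end Extensions

/-! ### Harder–Narasimhan decompositions -/

lemma Ioi_le_Ici {J : Type*} [Preorder J] {i j : J} (h : i < j) :
    UpperSet.Ioi i ≤ UpperSet.Ici j :=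
  fun _ hx => lt_of_lt_of_le h hx

lemma Ici_le_Ioi {J : Type*} [Preorder J] (i : J) : UpperSet.Ici i ≤ UpperSet.Ioi i :=
  fun _ hx => le_of_lt hx

section Slicings

variable {C : Type u} [Category.{v} C] [Preadditive C] [HasZeroObject C] [HasShift C ℤ]
  [∀ n : ℤ, (shiftFunctor C n).Additive] [Pretriangulated C]
  {J : Type*} [LinearOrder J] [AddAction ℤ J] [IsZPoset J]

namespace BridgelandSlicing

variable (s : BridgelandSlicing C J)

lemma upperPart_mono {U V : UpperSet J} (h : U ≤ V) :
    upperPart (s.toFun V) ≤ upperPart (s.toFun U) := s.monotone' h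

lemma lowerPart_mono {U V : UpperSet J} (h : U ≤ V) :
    lowerPart (s.toFun U) ≤ lowerPart (s.toFun V) := lowerPart_antitone (s.monotone' h)

lemma slice_hom_eq_zero {i j : J} (h : i < j) {X Y : C} (hX : s.slice j X) (hY : s.slice i Y)
    (f : X ⟶ Y) : f = 0 :=
  (s.toFun (.Ioi i)).zero' f (s.upperPart_mono (Ioi_le_Ici h) _ hX.1) hY.2

lemma slice_shift (n : ℤ) {j : J} {X : C} (hX : s.slice j X) :
    s.slice (n +ᵥ j) (X⟦n⟧) := by
  have key (a b : J) : a ≤ n +ᵥ b ↔ -n +ᵥ a ≤ b := by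
    constructor
    · intro h
      simpa using IsZPoset.vadd_mono (-n) h
    · intro h
      simpa using IsZPoset.vadd_mono n h
  have key' (a b : J) : n +ᵥ a ≤ b ↔ a ≤ -n +ᵥ b := by
    constructor
    · intro h
      simpa using IsZPoset.vadd_mono (-n) h
    · intro h
      simpa using IsZPoset.vadd_mono n h
  have h1 : UpperSet.Ici (n +ᵥ j) = n +ᵥ UpperSet.Ici j := by
    apply SetLike.coe_injective
    ext x
    rw [coe_vadd_upperSet, Set.mem_vadd_set_iff_neg_vadd_mem]
    exact key' _ _
  have h2 : UpperSet.Ioi (n +ᵥ j) = n +ᵥ UpperSet.Ioi j := by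
    apply SetLike.coe_injective
    ext x
    rw [coe_vadd_upperSet, Set.mem_vadd_set_iff_neg_vadd_mem]
    exact lt_iff_lt_of_le_iff_le (key _ _)
  constructor
  · rw [h1, s.map_vadd']
    exact (s.toFun (.Ici j)).le_shift 0 n (0 - n) (by lia) X hX.1
  · rw [h2, s.map_vadd']
    exact (s.toFun (.Ioi j)).ge_shift 1 n (1 - n) (by lia) X hX.2

variable [IsTriangulated C]

/-- The truncation `A` of `X` at `(a, +∞)` has no cohomology at indices `≤ a`, and the vanishing for
`X` passes to `A` at indices `> a`; discreteness then forces `A = 0`. -/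
lemma lowerPart_of_isZero_cohomologyOf {a : J} {X : C}
    (h : ∀ i, a < i → IsZero (cohomologyOf s.toFun i X)) :
    lowerPart (s.toFun (.Ioi a)) X := by
  obtain ⟨A, B, hA, hB, hX⟩ := exists_isExt_upperPart_lowerPart (s.toFun (.Ioi a)) X
  have hA0 : IsZero A := by
    refine s.discrete A fun i => ?_
    rcases le_or_gt i a with hi | hi
    · have hle : UpperSet.Ioi i ≤ UpperSet.Ioi a := fun x hx => lt_of_le_of_lt hi hx
      have hA' := s.upperPart_mono hle _ hA
      exact (isZero_cohomologyOf_iff _ i (IsExt.of_isZero_right (isZero_zero C) A)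
        (s.upperPart_mono (Ici_le_Ioi i) _ hA')
        (lowerPart_of_isZero _ (isZero_zero C))).2 hA'
    · obtain ⟨A₁, A₂, hA₁, hA₂, hA'⟩ := exists_isExt_upperPart_lowerPart (s.toFun (.Ici i)) A
      -- `T`, an extension of `B` by `A₂`, is in the lower part at `[i, +∞)`, so `A₁` truncates `X`
      -- as well as `A`.
      obtain ⟨T, hT₁, hT₂⟩ := hX.assoc_right hA'
      have hT := hT₂.lowerPart hA₂ (s.lowerPart_mono (Ioi_le_Ici hi) _ hB)
      exact (isZero_cohomologyOf_iff _ i hA' hA₁ hA₂).2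
        ((isZero_cohomologyOf_iff _ i hT₁ hA₁ hT).1 (h i hi))
  obtain ⟨e⟩ := hX.nonempty_iso_of_isZero hA0
  exact ((s.toFun (.Ioi a)).ge 1).prop_of_iso e.symm hB

lemma slice_of_isZero_cohomologyOf {a : J} {A X B : C}
    (h : ∀ i, a < i → IsZero (cohomologyOf s.toFun i X)) (hX : IsExt A X B)
    (hA : upperPart (s.toFun (.Ici a)) A) (hB : lowerPart (s.toFun (.Ici a)) B) :
    s.slice a A :=
  ⟨hA, hX.invRotate.lowerPart (lowerPart_shift (s.lowerPart_mono (Ici_le_Ioi a) _ hB))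
    (s.lowerPart_of_isZero_cohomologyOf h)⟩

/-- Removing the part at `[a, +∞)` creates no new cohomology below `a` and kills it from `a` on;
this drives the induction on the support. -/
lemma isZero_cohomologyOf_truncation {a i : J} {A X B : C} (hX : IsExt A X B)
    (hA : upperPart (s.toFun (.Ici a)) A) (hB : lowerPart (s.toFun (.Ici a)) B)
    (h : i < a → IsZero (cohomologyOf s.toFun i X)) : IsZero (cohomologyOf s.toFun i B) := by
  rcases lt_or_ge i a with hi | hi
  · obtain ⟨B₁, B₂, hB₁, hB₂, hB'⟩ := exists_isExt_upperPart_lowerPart (s.toFun (.Ici i)) B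
    obtain ⟨T, hT₁, hT₂⟩ := hX.assoc_left hB'
    have hAi := s.upperPart_mono (Ioi_le_Ici hi) _ hA
    have hT := hT₂.upperPart (s.upperPart_mono (Ici_le_Ioi i) _ hAi) hB₁
    exact (isZero_cohomologyOf_iff _ i hB' hB₁ hB₂).2 (hT₂.rotate.upperPart
      ((isZero_cohomologyOf_iff _ i hT₁ hT hB₂).1 (h hi)) (upperPart_shift hAi))
  · have hle : UpperSet.Ici a ≤ UpperSet.Ici i := fun x hx => le_trans hi hx
    exact (isZero_cohomologyOf_iff _ i (IsExt.of_isZero_left (isZero_zero C) B)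
      (upperPart_of_isZero _ (isZero_zero C)) (s.lowerPart_mono hle _ hB)).2
      (upperPart_of_isZero _ (isZero_zero C))

/-- The Harder–Narasimhan filtration of an object can be reordered with respect to a set `U` of
indices, provided that the extensions which have to be exchanged split. -/
lemma exists_isExt_of_support (U : Set J)
    (hU : ∀ i j, i < j → i ∈ U → j ∉ U → ∀ X Y, s.slice i X → s.slice j Y →
      ∀ f : X ⟶ Y⟦(1 : ℤ)⟧, f = 0) (F : Finset J) :
    ∀ X : C, (∀ j ∉ F, IsZero (cohomologyOf s.toFun j X)) →
      ∃ A B, IsExt A X B ∧ extensionClosure (fun Y => ∃ j ∈ F, j ∈ U ∧ s.slice j Y) A ∧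
        extensionClosure (fun Y => ∃ j ∈ F, j ∉ U ∧ s.slice j Y) B := by
  induction F using Finset.induction_on_max with
  | empty =>
    intro X hX
    exact ⟨X, X, IsExt.of_isZero_left (s.discrete X fun j => hX j (by simp)) X,
      .zero _ (s.discrete X fun j => hX j (by simp)), .zero _ (s.discrete X fun j => hX j (by simp))⟩
  | insert a F ha ih =>
    intro X hX
    -- Peel off the largest index `a`: `D` is its slice component, and `Y` is supported on `F`.
    obtain ⟨D, Y, hD, hY, hXDY⟩ := exists_isExt_upperPart_lowerPart (s.toFun (.Ici a)) X
    have hDa : s.slice a D := s.slice_of_isZero_cohomologyOf (fun i hi => hX i (by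
      rw [Finset.mem_insert, not_or]
      exact ⟨hi.ne', fun h => (ha i h).not_gt hi⟩)) hXDY hD hY
    obtain ⟨A, B, hYAB, hA, hB⟩ := ih Y fun j hj =>
      s.isZero_cohomologyOf_truncation hXDY hD hY fun hja => hX j (by
        rw [Finset.mem_insert, not_or]
        exact ⟨hja.ne, hj⟩)
    have hA' := extensionClosure.mono (Q := fun Y => ∃ j ∈ insert a F, j ∈ U ∧ s.slice j Y)
      (fun Z ⟨j, hj, h⟩ => ⟨j, Finset.mem_insert_of_mem hj, h⟩) _ hA
    have hB' := extensionClosure.mono (Q := fun Y => ∃ j ∈ insert a F, j ∉ U ∧ s.slice j Y)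
      (fun Z ⟨j, hj, h⟩ => ⟨j, Finset.mem_insert_of_mem hj, h⟩) _ hB
    obtain ⟨T, hT₁, hT₂⟩ := hXDY.assoc_left hYAB
    by_cases haU : a ∈ U
    · exact ⟨T, B, hT₁, .of_isExt hT₂ (.of _ ⟨a, Finset.mem_insert_self a F, haU, hDa⟩) hA', hB'⟩
    -- Here `D` precedes `A` but belongs on the other side; `A` is built from indices `j < a` in
    -- `U`, so the hypothesis splits `T` and `D` moves past `A`.
    · have hT₃ := hT₂.swap fun f => extensionClosure.hom_eq_zero_left
        (fun Z ⟨j, hj, hjU, hZ⟩ => hU j a (ha j hj) hjU haU Z D hZ hDa) hA f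
      obtain ⟨S, hS₁, hS₂⟩ := hT₁.assoc_right hT₃
      exact ⟨A, S, hS₁, hA',
        .of_isExt hS₂ (.of _ ⟨a, Finset.mem_insert_self a F, haU, hDa⟩) hB'⟩

lemma exists_finset_extensionClosure (X : C) :
    ∃ F : Finset J, extensionClosure (fun Y => ∃ j ∈ F, s.slice j Y) X := by
  -- With `U` everything, nothing is exchanged and the splitting condition is vacuous.
  obtain ⟨A, B, h, hA, hB⟩ := s.exists_isExt_of_support Set.univ
    (fun _ j _ _ hj => (hj (Set.mem_univ j)).elim) (s.finite X).toFinset X (fun j hj => by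
      simpa using hj)
  exact ⟨_, .of_isExt h (extensionClosure.mono (fun _ ⟨j, hj, _, h⟩ => ⟨j, hj, h⟩) _ hA)
    (extensionClosure.mono (fun _ ⟨j, hj, _, h⟩ => ⟨j, hj, h⟩) _ hB)⟩

end BridgelandSlicing

end Slicings

/-! ### Upper sets of `ℤ × ℤ` and perversity functions -/

lemma LexIndex.lt_iff (m n : ℤ) (ψ φ : ZHat) :
    (toLex (m, ψ) : LexIndex) < toLex (n, φ) ↔ m < n ∨ m = n ∧ ψ.val < φ.val :=
  Prod.Lex.toLex_lt_toLex

lemma mem_upperSet_iff (p : PerversityFunction) (x : ℤ × ℤ) :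
    x ∈ p.upperSet ↔ 1 ≤ x.1 + p.toFun (x.2 - x.1) := by
  obtain ⟨a, b⟩ := x
  have h : (a, b) ∈ p.upperSet ↔ ¬ ∃ y : ℤ × ℤ, p.toFun y.1 - y.1 ≤ y.2 ∧
      (-y.1 - y.2, -y.2) = (a, b) := Iff.rfl
  rw [h, ← not_lt, not_iff_not]
  constructor
  · rintro ⟨⟨n, m⟩, h1, h2⟩
    simp only [Prod.mk.injEq] at h1 h2
    obtain ⟨rfl, rfl⟩ := h2
    simp only [show -m - (-n - m) = n by ring]
    lia
  · intro h
    refine ⟨(b - a, -b), ?_, ?_⟩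
    · simp only at h ⊢
      lia
    · ext <;> simp

lemma mem_of_mem_of_le {U : UpperSet (ℤ × ℤ)} {a b a' b' : ℤ} (h : (a, b) ∈ U) (ha : a ≤ a')
    (hb : b ≤ b') : (a', b') ∈ U :=
  U.upper (show ((a, b) : ℤ × ℤ) ≤ (a', b') from ⟨ha, hb⟩) h

/-- Every upper set of `ℤ × ℤ` other than the two trivial ones comes from a perversity function. -/
lemma exists_perversityFunction {U : UpperSet (ℤ × ℤ)} (h₁ : U ≠ ⊤) (h₂ : U ≠ ⊥) :
    ∃ p : PerversityFunction, p.upperSet = U := by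
  obtain ⟨⟨a, b⟩, hab⟩ : ∃ x, x ∈ U := by
    by_contra! h
    exact h₁ (SetLike.ext fun x => by simp [h x])
  obtain ⟨⟨c, d⟩, hcd⟩ : ∃ x, x ∉ U := by
    by_contra! h
    exact h₂ (SetLike.ext fun x => by simp [h x])
  -- Each diagonal `b - a = n` meets `U` in a ray: it is bounded below by the point `(c, d)` outside
  -- `U` and nonempty by the point `(a, b)` inside. The start `m n` gives `p n = 1 - m n`.
  have key (n : ℤ) : ∃ m : ℤ, ∀ k : ℤ, (k, k + n) ∈ U ↔ m ≤ k := by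
    obtain ⟨m, hm, hm'⟩ := Int.exists_least_of_bdd (P := fun k => (k, k + n) ∈ U)
      ⟨min c (d - n), fun k hk => by
        by_contra! hlt
        exact hcd (mem_of_mem_of_le hk (by lia) (by lia))⟩
      ⟨max a (b - n), mem_of_mem_of_le hab (by lia) (by lia)⟩
    exact ⟨m, fun k => ⟨hm' k, fun hk => mem_of_mem_of_le hm (by lia) (by lia)⟩⟩
  choose m hm using key
  refine ⟨⟨fun n => 1 - m n, fun n => ?_, fun n => ?_⟩, SetLike.ext fun ⟨x, y⟩ => ?_⟩
  · have := (hm (n + 1) (m n)).1 (mem_of_mem_of_le ((hm n (m n)).2 le_rfl) le_rfl (by lia))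
    lia
  · have := (hm n (m (n + 1) + 1)).1
      (mem_of_mem_of_le ((hm (n + 1) (m (n + 1))).2 le_rfl) (by lia) (by lia))
    lia
  · have := hm (y - x) x
    rw [add_sub_cancel] at this
    rw [mem_upperSet_iff, this]
    simp only
    lia

/-! ### Gluing slices along an upper set -/

section Glue

variable {C : Type u} [Category.{v} C] [Preadditive C] [HasZeroObject C] [HasShift C ℤ]
  [∀ n : ℤ, (shiftFunctor C n).Additive] [Pretriangulated C]

lemma AbelianSlicing.slice_lex_shift {t : TStructure C} (s : AbelianSlicing t) (a : ℤ) {n : ℤ}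
    {φ : ZHat} {X : C} (hX : s.slice (toLex (n, φ)) X) :
    s.slice (toLex (a + n, φ)) (X⟦a⟧) :=
  s.slice_shift a hX

lemma AbelianSlicing.IsGluable.hom_eq_zero {t : TStructure C} {s : AbelianSlicing t}
    (hs : s.IsGluable) {m n : ℤ} {ψ φ : ZHat} (hmn : m < n) (h : φ.val < ψ.val) {X Y : C}
    (hX : s.slice (toLex (m, ψ)) X) (hY : s.slice (toLex (n, φ)) Y) (f : X ⟶ Y) : f = 0 := by
  have hX' : s.heartSlice ψ (X⟦-m⟧) := by
    have := s.slice_lex_shift (-m) hX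
    rwa [neg_add_cancel] at this
  have hY' : s.heartSlice φ (Y⟦-n⟧) := by
    have := s.slice_lex_shift (-n) hY
    rwa [neg_add_cancel] at this
  let e : Y⟦-m⟧ ≅ (Y⟦-n⟧)⟦n - m⟧ := (shiftFunctorAdd' C (-n) (n - m) (-m) (by lia)).app Y
  have h0 := hs ψ φ (n - m) h (by lia) _ _ hX' hY' (f⟦-m⟧' ≫ e.hom)
  apply (shiftFunctor C (-m)).map_injective
  rw [← cancel_mono e.hom, h0, Functor.map_zero, zero_comp]

/-- The indices of the slices which generate the upper subcategory attached to `U`, shifted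
by `k`. -/
def glueIndex (U : UpperSet (ℤ × ℤ)) (k : ℤ) : Set LexIndex :=
  {j | ((ofLex j).1 + k + 1, (ofLex j).1 + k + 1 + (ofLex j).2.val) ∈ U}

lemma glueIndex_mono (U : UpperSet (ℤ × ℤ)) {k l : ℤ} (h : k ≤ l) :
    glueIndex U k ⊆ glueIndex U l :=
  fun _ hj => mem_of_mem_of_le hj (by lia) (by lia)

lemma vadd_mem_glueIndex_iff (U : UpperSet (ℤ × ℤ)) (a k : ℤ) (j : LexIndex) :
    a +ᵥ j ∈ glueIndex U k ↔ j ∈ glueIndex U (a + k) := by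
  obtain ⟨n, φ⟩ := j
  change (a + n + k + 1, a + n + k + 1 + φ.val) ∈ U ↔
    (n + (a + k) + 1, n + (a + k) + 1 + φ.val) ∈ U
  rw [show n + (a + k) + 1 = a + n + k + 1 by ring]

lemma glueIndex_vadd (U : UpperSet (ℤ × ℤ)) (a k : ℤ) :
    glueIndex (a +ᵥ U) k = glueIndex U (k - a) := by
  ext ⟨n, φ⟩
  change (n + k + 1, n + k + 1 + φ.val) ∈ ((a +ᵥ U : UpperSet (ℤ × ℤ)) : Set (ℤ × ℤ)) ↔
    (n + (k - a) + 1, n + (k - a) + 1 + φ.val) ∈ U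
  rw [coe_vadd_upperSet, Set.mem_vadd_set_iff_neg_vadd_mem]
  change (-a + (n + k + 1), -a + (n + k + 1 + φ.val)) ∈ U ↔ _
  rw [show -a + (n + k + 1) = n + (k - a) + 1 by ring,
    show -a + (n + k + 1 + φ.val) = n + (k - a) + 1 + φ.val by ring]

/-- The `+ 1` in `glueIndex` cancels the `1` in `mem_upperSet_iff`, so degree `k = 0` corresponds to
`γ_p ≥ 0`. -/
lemma mem_glueIndex_upperSet_iff (p : PerversityFunction) (k : ℤ) (j : LexIndex) :
    j ∈ glueIndex p.upperSet k ↔ -k ≤ p.gamma j := by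
  refine (mem_upperSet_iff p _).trans ?_
  rw [add_sub_cancel_left, PerversityFunction.gamma]
  lia

/-- The extension-closed subcategory generated by the slices with index in `I`. -/
def slicesClosure {t : TStructure C} (s : AbelianSlicing t) (I : Set LexIndex) :
    ObjectProperty C :=
  extensionClosure (fun X => ∃ j, j ∈ I ∧ s.slice j X)

instance {t : TStructure C} (s : AbelianSlicing t) (I : Set LexIndex) :
    (slicesClosure s I).IsClosedUnderIsomorphisms :=
  inferInstanceAs (extensionClosure _).IsClosedUnderIsomorphisms

lemma slicesClosure_mono {t : TStructure C} (s : AbelianSlicing t) {I I' : Set LexIndex}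
    (h : I ⊆ I') : slicesClosure s I ≤ slicesClosure s I' :=
  extensionClosure.mono fun _ ⟨j, hj, hX⟩ => ⟨j, h hj, hX⟩

lemma slicesClosure_shift {t : TStructure C} (s : AbelianSlicing t) {I I' : Set LexIndex} (a : ℤ)
    (h : ∀ j ∈ I, a +ᵥ j ∈ I') {X : C} (hX : slicesClosure s I X) :
    slicesClosure s I' (X⟦a⟧) :=
  extensionClosure.shift a (fun _ ⟨j, hj, hX⟩ => ⟨a +ᵥ j, h j hj, s.slice_shift a hX⟩) hX

lemma slicesClosure_hom_eq_zero {t : TStructure C} {s : AbelianSlicing t} (hs : s.IsGluable)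
    (U : UpperSet (ℤ × ℤ)) (k : ℤ) {X Y : C} (hX : slicesClosure s (glueIndex U k) X)
    (hY : slicesClosure s (glueIndex U k)ᶜ Y) (f : X ⟶ Y) : f = 0 := by
  refine extensionClosure.hom_eq_zero ?_ hX hY f
  rintro X Y ⟨⟨n, φ⟩, hi, hX⟩ ⟨⟨m, ψ⟩, hj, hY⟩ f
  by_cases hlt : (toLex (m, ψ) : LexIndex) < toLex (n, φ)
  · exact s.slice_hom_eq_zero hlt hX hY f
  · rw [LexIndex.lt_iff] at hlt
    have h : m + ψ.val < n + φ.val := by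
      by_contra! h
      exact hj (mem_of_mem_of_le hi (show n + k + 1 ≤ m + k + 1 by lia)
        (show n + k + 1 + φ.val ≤ m + k + 1 + ψ.val by lia))
    exact hs.hom_eq_zero (by lia) (by lia) hX hY f

lemma IsInduced.unique {t : TStructure C} {s : AbelianSlicing t}
    {Ψ Ψ' : UpperSet (ℤ × ℤ) → TStructure C} (h : IsInduced s Ψ) (h' : IsInduced s Ψ') :
    Ψ' = Ψ := by
  funext U
  by_cases h₁ : U = ⊤
  · subst h₁
    exact le_antisymm (h.2.1 _) (h'.2.1 _)
  by_cases h₂ : U = ⊥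
  · subst h₂
    exact le_antisymm (h'.2.2 _) (h.2.2 _)
  obtain ⟨p, rfl⟩ := exists_perversityFunction h₁ h₂
  have := tStructure_ext ((h'.1 p 0).1.trans (h.1 p 0).1.symm)
  simpa using this

variable [IsTriangulated C]

lemma exists_isExt_slicesClosure {t : TStructure C} {s : AbelianSlicing t} (hs : s.IsGluable)
    (U : UpperSet (ℤ × ℤ)) (k : ℤ) (X : C) :
    ∃ A B, slicesClosure s (glueIndex U k) A ∧ slicesClosure s (glueIndex U k)ᶜ B ∧
      IsExt A X B := by
  obtain ⟨A, B, h, hA, hB⟩ := s.exists_isExt_of_support (glueIndex U k) (by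
    rintro ⟨m, ψ⟩ ⟨n, φ⟩ hlt hi hj X Y hX hY f
    replace hlt := (LexIndex.lt_iff m n ψ φ).1 hlt
    have h : n + φ.val < m + ψ.val := by
      by_contra! h
      exact hj (mem_of_mem_of_le hi (show m + k + 1 ≤ n + k + 1 by lia)
        (show m + k + 1 + ψ.val ≤ n + k + 1 + φ.val by lia))
    -- `Y⟦1⟧` has index `(1 + n, φ)`, so the case `m = n` is also covered.
    exact hs.hom_eq_zero (φ := φ) (show m < 1 + n by lia) (by lia) hX (s.slice_lex_shift 1 hY) f)
    (s.finite X).toFinset X (fun j hj => by simpa using hj)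
  exact ⟨A, B, extensionClosure.mono (fun _ ⟨j, _, hj, h⟩ => ⟨j, hj, h⟩) _ hA,
    extensionClosure.mono (fun _ ⟨j, _, hj, h⟩ => ⟨j, hj, h⟩) _ hB, h⟩

/-- The t-structure glued from the slices of a gluable abelian slicing according to an upper set
of `ℤ × ℤ`. -/
def glue {t : TStructure C} {s : AbelianSlicing t} (hs : s.IsGluable) (U : UpperSet (ℤ × ℤ)) :
    TStructure C where
  le k := slicesClosure s (glueIndex U k)
  ge k := slicesClosure s (glueIndex U (k - 1))ᶜ
  le_shift k a k' h X hX := slicesClosure_shift s a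
    (fun j hj => by rwa [vadd_mem_glueIndex_iff, h]) hX
  ge_shift k a k' h X hX := slicesClosure_shift s a
    (fun j hj => by
      rwa [Set.mem_compl_iff, vadd_mem_glueIndex_iff, show a + (k' - 1) = k - 1 by lia]) hX
  zero' X Y f hX hY := slicesClosure_hom_eq_zero hs U 0 hX (by rwa [sub_self] at hY) f
  le_zero_le := slicesClosure_mono s (glueIndex_mono U (by lia))
  ge_one_le := slicesClosure_mono s (Set.compl_subset_compl.2 (glueIndex_mono U (by lia)))
  exists_triangle_zero_one X := by
    obtain ⟨A, B, hA, hB, f, g, h, hT⟩ := exists_isExt_slicesClosure hs U 0 X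
    exact ⟨A, B, hA, by rwa [sub_self], f, g, h, hT⟩

/-- The morphism of `ℤ`-posets sending an upper set of `ℤ × ℤ` to the glued t-structure. -/
def glueHom {t : TStructure C} {s : AbelianSlicing t} (hs : s.IsGluable) :
    ZPosetHom (UpperSet (ℤ × ℤ)) (TStructure C) where
  toFun := glue hs
  monotone' _ _ h := slicesClosure_mono s fun _ hj => h hj
  map_vadd' n U := tStructure_ext (congrArg (slicesClosure s) (glueIndex_vadd U n 0))

lemma isInduced_glue {t : TStructure C} {s : AbelianSlicing t} (hs : s.IsGluable) :
    IsInduced s (glue hs) := by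
  refine ⟨fun p n => ⟨?_, ?_⟩, fun t' => ?_, fun t' X _ => ?_⟩
  · refine congrArg (slicesClosure s) (Set.ext fun j => ?_)
    rw [mem_glueIndex_upperSet_iff, zero_sub, neg_neg]
    rfl
  · refine congrArg (slicesClosure s) (Set.ext fun j => ?_)
    rw [Set.mem_compl_iff, mem_glueIndex_upperSet_iff, show -(1 - n - 1) = n by lia]
    rfl
  · intro X hX
    change slicesClosure s (glueIndex ⊤ 0) X at hX
    induction hX with
    | zero X hX => exact upperPart_of_isZero t' hX
    | of X hX =>
      obtain ⟨j, hj, -⟩ := hX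
      exact hj.elim
    | ext T hT _ _ h₁ h₃ => exact (IsExt.of_triangle T hT).upperPart h₁ h₃
  · obtain ⟨F, hF⟩ := s.exists_finset_extensionClosure X
    exact extensionClosure.mono (fun _ ⟨j, _, h⟩ => ⟨j, trivial, h⟩) _ hF

lemma isBounded_glue {t : TStructure C} {s : AbelianSlicing t} (hs : s.IsGluable)
    {U : UpperSet (ℤ × ℤ)} (h₁ : (U : Set (ℤ × ℤ)).Nonempty) (h₂ : (U : Set (ℤ × ℤ)) ≠ Set.univ) :
    IsBounded (glue hs U) := by
  obtain ⟨⟨a, b⟩, hab⟩ := h₁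
  obtain ⟨⟨c, d⟩, hcd⟩ := (Set.ne_univ_iff_exists_notMem _).1 h₂
  intro X
  obtain ⟨F, hF⟩ := s.exists_finset_extensionClosure X
  -- From `k ≥ M j` on, the point attached to `j` dominates `(a, b) ∈ U`; for `l ≥ N j`, in degree
  -- `-l`, it lies below `(c, d) ∉ U`.
  let M (j : LexIndex) : ℤ := max (a - (ofLex j).1) (b - (ofLex j).1 - (ofLex j).2.val)
  let N (j : LexIndex) : ℤ := max ((ofLex j).1 - c) ((ofLex j).1 + (ofLex j).2.val - d)
  obtain ⟨k, hk⟩ := (F.image M).exists_le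
  obtain ⟨l, hl⟩ := (F.image N).exists_le
  constructor
  · refine ⟨-l, ⟨extensionClosure.mono (fun Y ⟨j, hj, hY⟩ => ⟨j, fun hjU => hcd ?_, hY⟩) _ hF⟩⟩
    have := max_le_iff.1 (hl _ (Finset.mem_image_of_mem N hj))
    exact mem_of_mem_of_le hjU (by lia) (by lia)
  · refine ⟨k, ⟨extensionClosure.mono (fun Y ⟨j, hj, hY⟩ => ⟨j, ?_, hY⟩) _ hF⟩⟩
    have := max_le_iff.1 (hk _ (Finset.mem_image_of_mem M hj))
    exact mem_of_mem_of_le hab (by lia) (by lia)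

end Glue

end Gluing

theorem mainTheorem1 {C : Type u} [Category.{v} C] [Preadditive C] [HasZeroObject C]
    [HasShift C ℤ] [∀ n : ℤ, (shiftFunctor C n).Additive] [Pretriangulated C] [IsTriangulated C]
    (t : TStructure C) (ht : Gluing.IsBounded t)
    (s : Gluing.AbelianSlicing t) (hs : s.IsGluable) :
    ∃ Ψ : Gluing.ZPosetHom (UpperSet (ℤ × ℤ)) (TStructure C),
      Gluing.IsInduced s Ψ ∧
      (∀ Ψ' : UpperSet (ℤ × ℤ) → TStructure C, Gluing.IsInduced s Ψ' → Ψ' = Ψ) ∧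
      ∀ U : UpperSet (ℤ × ℤ), (U : Set (ℤ × ℤ)).Nonempty → (U : Set (ℤ × ℤ)) ≠ Set.univ →
        Gluing.IsBounded (Ψ U) :=
  ⟨Gluing.glueHom hs, Gluing.isInduced_glue hs,
    fun _ h => Gluing.IsInduced.unique (Gluing.isInduced_glue hs) h,
    fun _ h₁ h₂ => Gluing.isBounded_glue hs h₁ h₂⟩
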